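/- Let $\mathrm{Atoms}$ be a countably infinite set, let $\binom{\mathrm{Atoms}}{2}$ be the set of its two-element subsets, and let $\Gamma=\mathrm{Atoms}\times\binom{\mathrm{Atoms}}{2}$. All permutations $\pi$ of $\mathrm{Atoms}$ act on $\Gamma$, on finite multisets over $\Gamma$ (called data vectors), on sets of these, and so on, by renaming atoms. A set with atoms (or an element of one) is finitely supported if, for some finite $S\subseteq\mathrm{Atoms}$, it is fixed by every permutation that fixes each element of $S$. A finitely supported set of finitely supported elements is orbit-finite if it meets only finitely many orbits of the group of permutations of $\mathrm{Atoms}$. An orbit-finite union is a union $\bigcup_{i\in I}X_i$ where $I$ is orbit-finite and the function $i\mapsto X_i$ on $I$ is finitely supported. The rational sets of data vectors form the smallest class of sets of data vectors that contains all singletons and is closed under Minkowski sums $X+Y$, under $X^*=\{x_1+\dots+x_n : n\ge 0,\ x_1,\dots,x_n\in X\}$, and under orbit-finite unions. For atoms $a,b,c$, let the anti-path language $\mathrm{AP}_{bc,a}\subseteq\Gamma^*$ consist of all nonempty words $$\langle a_1,\{b_1,c_1\}\rangle\,\langle a_2,\{b_2,c_2\}\rangle\cdots\langle a_n,\{b_n,c_n\}\rangle\qquad(n\ge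 1)$$ over $\Gamma$ such that $a_{i+1}\notin\{b_i,c_i\}$ for all $i=0,1,\dots,n$, where $b_0=b$, $c_0=c$ and $a_{n+1}=a$. **Lemma.** For all atoms $a,b,c$, the Parikh image of $\mathrm{AP}_{bc,a}$, that is, the set of the multisets of letters of its words, is a rational set of data vectors. -/

import Mathlib

open scoped Pointwise

universe u v

/-- An element `x` of a set on which the atom permutations act is finitely supported: there is a
finite set `S` of atoms such that every permutation fixing all atoms of `S` fixes `x`. -/
def FinitelySupported (Atoms : Type u) {I : Type v} [SMul (Equiv.Perm Atoms) I] (x : I) : Prop :=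
  ∃ S : Finset Atoms, MulAction.Supports (Equiv.Perm Atoms) (S : Set Atoms) x

/-- A set `J` with atoms is (legal and) orbit-finite: it is finitely supported, all its elements are
finitely supported, and it splits into finitely many orbits. -/
structure OrbitFinite (Atoms : Type u) {I : Type v} [MulAction (Equiv.Perm Atoms) I]
    (J : Set I) : Prop where
  supported : FinitelySupported Atoms J
  supported_mem : ∀ i ∈ J, FinitelySupported Atoms i
  finite_orbits : ((fun i => MulAction.orbit (Equiv.Perm Atoms) i) '' J).Finite

/-- Data vectors over an alphabet `A` are the finite multisets of letters. -/
abbrev DataVector (A : Type v) := Multiset A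

/-- Renaming of atoms in a data vector: every letter is renamed. -/
def DataVector.permute {Atoms : Type u} {A : Type v} [SMul (Equiv.Perm Atoms) A]
    (π : Equiv.Perm Atoms) (x : DataVector A) : DataVector A :=
  Multiset.map (fun α => π • α) x

/-- The family `(X i)`, `i ∈ J`, of sets of data vectors is legal: the indexing function with
domain `J` is finitely supported. -/
def LegalFamily (Atoms : Type u) {A : Type v} [SMul (Equiv.Perm Atoms) A]
    {I : Type u} [SMul (Equiv.Perm Atoms) I] (J : Set I) (X : I → Set (DataVector A)) : Prop :=
  ∃ S : Finset Atoms, ∀ π : Equiv.Perm Atoms, (∀ a ∈ S, π a = a) →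
    π • J = J ∧ ∀ i ∈ J, X (π • i) = DataVector.permute π '' X i

/-- `X*`, the set of all finite sums of elements of `X`. -/
def sumStar {A : Type v} (X : Set (DataVector A)) : Set (DataVector A) :=
  {x | ∃ l : List (DataVector A), (∀ y ∈ l, y ∈ X) ∧ x = l.sum}

/-- Rational sets of data vectors: the smallest class of sets of data vectors that contains all
singletons and is closed under (Minkowski) addition, star, and orbit-finite unions. -/
inductive IsRational (Atoms : Type u) {A : Type v} [SMul (Equiv.Perm Atoms) A] :
    Set (DataVector A) → Prop
  | singleton (x : DataVector A) : IsRational Atoms {x}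
  | add (X Y : Set (DataVector A)) :
      IsRational Atoms X → IsRational Atoms Y → IsRational Atoms (X + Y)
  | star (X : Set (DataVector A)) : IsRational Atoms X → IsRational Atoms (sumStar X)
  | iUnion {I : Type u} [MulAction (Equiv.Perm Atoms) I] (J : Set I)
      (X : I → Set (DataVector A)) :
      OrbitFinite Atoms J → LegalFamily Atoms J X → (∀ i ∈ J, IsRational Atoms (X i)) →
      IsRational Atoms (⋃ i ∈ J, X i)

/-- The Parikh image of a word: the multiset of its letters. -/
def parikh {A : Type v} (w : List A) : DataVector A := (w : Multiset A)

/-- A language has rational Parikh image. -/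
def HasRationalParikhImage (Atoms : Type u) {A : Type v} [SMul (Equiv.Perm Atoms) A]
    (L : Set (List A)) : Prop :=
  IsRational Atoms (parikh '' L)

/-- The alphabet `Γ`: pairs of an atom (the source) and a 2-element set of atoms (the target).
Atom permutations act on it by renaming atoms. -/
abbrev Letter (Atoms : Type u) := Atoms × Set.powersetCard Atoms 2

/-- The anti-path language with parameters `b, c, a`: nonempty words such that the first source is
not in `{b, c}`, the source of every later letter is not in the target of the preceding letter, and
`a` is not in the last target. -/
def antiPaths {Atoms : Type u} (b c a : Atoms) : Set (List (Letter Atoms)) :=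
  {w | w ≠ [] ∧ (∀ α ∈ w.head?, α.1 ≠ b ∧ α.1 ≠ c) ∧
    w.IsChain (fun α β => β.1 ∉ α.2) ∧ (∀ α ∈ w.getLast?, a ∉ α.2)}

/-! View a word as a path whose edges join each target to the source that follows it; an anti-path
is a word all of whose edges avoid membership. Two edges can be crossed, exchanging their sources,
unless one source lies in the other target. Targets have at most two atoms, so at most five edges
can conflict pairwise (`length_le_five_of_pairwise_conflict`). Crossing two edges cuts a loop out of
a word, so every anti-path is, up to reordering of letters, a core of bounded length together with
loops of at most six letters (`exists_reduction`).

The loops must also fit back in, in any number. A loop fits before a letter having the same source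
as its head, or before the end if that source is the final one. If its head's source does not occur,
the core should be roomy for it: such loops merge at their heads until at most five remain, and
these are inserted at different edges (`exists_insert_periods`). A choice of at most 21 edges to be
protected while loops are cut out ensures that every loop is of one of these two kinds
(`exists_sublist_roomy`, `exists_core`).

Hence the Parikh image is the union, over bounded cores, of the core plus the star of its bounded
periods (`parikh_image_antiPaths`). All conditions are equivariant and words of bounded length form
orbit-finite sets, so both unions are legal. -/

section Words

/-! ### Words as paths from a target to a source. -/

variable {Atoms : Type u}

/-- The target of the last letter of `w`, or `T` if `w` is empty. -/
def lastTarget (T : Finset Atoms) : List (Letter Atoms) → Finset Atoms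
  | [] => T
  | α :: w => lastTarget α.2.1 w

/-- The pairs of a target and the source following it along the word `w`, where the target `T`
precedes `w` and the source `p` follows it. -/
def edges (T : Finset Atoms) : List (Letter Atoms) → Atoms → List (Finset Atoms × Atoms)
  | [], p => [(T, p)]
  | α :: w, p => (T, α.1) :: edges α.2.1 w p

/-- The word `w` leads from the target `T` to the source `p`: no source belongs to the target that
precedes it. -/
def Leads (T : Finset Atoms) (w : List (Letter Atoms)) (p : Atoms) : Prop :=
  ∀ e ∈ edges T w p, e.2 ∉ e.1

/-- The nonempty word with head `q.1` and tail `q.2` can follow itself. -/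
def IsLoop (q : Letter Atoms × List (Letter Atoms)) : Prop :=
  Leads q.1.2.1 q.2 q.1.1

/-- The word with head `q.1` and tail `q.2`. -/
def toWord (q : Letter Atoms × List (Letter Atoms)) : List (Letter Atoms) := q.1 :: q.2

theorem leads_nil {T : Finset Atoms} {p : Atoms} : Leads T [] p ↔ p ∉ T := by
  simp [Leads, edges]

theorem leads_cons {T : Finset Atoms} {α : Letter Atoms} {w : List (Letter Atoms)} {p : Atoms} :
    Leads T (α :: w) p ↔ α.1 ∉ T ∧ Leads α.2.1 w p := by
  simp [Leads, edges]

theorem edges_append_cons (T : Finset Atoms) (u : List (Letter Atoms)) (β : Letter Atoms)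
    (v : List (Letter Atoms)) (p : Atoms) :
    edges T (u ++ β :: v) p = edges T u β.1 ++ edges β.2.1 v p := by
  induction u generalizing T with
  | nil => rfl
  | cons α u ih => simp [edges, ih]

theorem leads_append_cons {T : Finset Atoms} {u : List (Letter Atoms)} {β : Letter Atoms}
    {v : List (Letter Atoms)} {p : Atoms} :
    Leads T (u ++ β :: v) p ↔ Leads T u β.1 ∧ Leads β.2.1 v p := by
  simp only [Leads, edges_append_cons, List.mem_append]
  grind

theorem map_snd_edges (T : Finset Atoms) (w : List (Letter Atoms)) (p : Atoms) :
    (edges T w p).map Prod.snd = w.map Prod.fst ++ [p] := by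
  induction w generalizing T with
  | nil => rfl
  | cons α w ih => simp [edges, ih]

theorem Leads.notMem_lastTarget {T : Finset Atoms} {w : List (Letter Atoms)} {p : Atoms}
    (h : Leads T w p) : p ∉ lastTarget T w := by
  induction w generalizing T with
  | nil => exact leads_nil.1 h
  | cons α w ih => exact ih (leads_cons.1 h).2

/-- Only the last edge depends on the final source. This is what lets loops be cut, merged and
inserted. -/
theorem Leads.change {T : Finset Atoms} {w : List (Letter Atoms)} {p p' : Atoms}
    (h : Leads T w p) (h' : p' ∉ lastTarget T w) : Leads T w p' := by
  induction w generalizing T with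
  | nil => exact leads_nil.2 h'
  | cons α w ih => exact leads_cons.2 ⟨(leads_cons.1 h).1, ih (leads_cons.1 h).2 h'⟩

theorem lastTarget_append (T : Finset Atoms) (u v : List (Letter Atoms)) :
    lastTarget T (u ++ v) = lastTarget (lastTarget T u) v := by
  induction u generalizing T with
  | nil => rfl
  | cons α u ih => exact ih _

theorem card_lastTarget_le {T : Finset Atoms} (hT : T.card ≤ 2) (w : List (Letter Atoms)) :
    (lastTarget T w).card ≤ 2 := by
  induction w generalizing T with
  | nil => exact hT
  | cons α w ih => exact ih α.2.2.le

theorem card_fst_le_of_mem_edges {T : Finset Atoms} (hT : T.card ≤ 2) {w : List (Letter Atoms)}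
    {p : Atoms} {e : Finset Atoms × Atoms} (he : e ∈ edges T w p) : e.1.card ≤ 2 := by
  induction w generalizing T with
  | nil => simp_all [edges]
  | cons α w ih =>
    rcases List.mem_cons.1 he with rfl | he
    · exact hT
    · exact ih α.2.2.le he

/-! ### Cutting loops out of long words. -/

/-- Two edges cannot be crossed. -/
def Conflict (e f : Finset Atoms × Atoms) : Prop := f.2 ∈ e.1 ∨ e.2 ∈ f.1

/-- Conflicting edges have distinct sources, so each target contains at most two of the `n` sources.
Counting ordered pairs gives `n * n ≤ 2 * n + 2 * n + n`. -/
theorem length_le_five_of_pairwise_conflict [DecidableEq Atoms]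
    {L : List (Finset Atoms × Atoms)} (hL : ∀ e ∈ L, e.2 ∉ e.1 ∧ e.1.card ≤ 2)
    (h : L.Pairwise Conflict) : L.length ≤ 5 := by
  have hc : ∀ i j : Fin L.length, i ≠ j → Conflict (L.get i) (L.get j) := by
    intro i j hij
    rcases lt_or_gt_of_ne hij with hlt | hlt
    · exact List.pairwise_iff_get.1 h i j hlt
    · exact (List.pairwise_iff_get.1 h j i hlt).symm
  have hinj : ∀ i j : Fin L.length, (L.get i).2 = (L.get j).2 → i = j := by
    intro i j hij
    by_contra hne
    rcases hc i j hne with h' | h'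
    · exact (hL _ (L.get_mem i)).1 (hij ▸ h')
    · exact (hL _ (L.get_mem j)).1 (hij ▸ h')
  have hdeg : ∀ i : Fin L.length,
      (Finset.univ.filter fun j => (L.get j).2 ∈ (L.get i).1).card ≤ 2 := by
    intro i
    refine le_trans ?_ (hL _ (L.get_mem i)).2
    exact Finset.card_le_card_of_injOn (fun j => (L.get j).2) (fun j hj => by simpa using hj)
      (fun j _ k _ hjk => hinj j k hjk)
  have hout : ∑ i : Fin L.length, ∑ j : Fin L.length,
      (if (L.get j).2 ∈ (L.get i).1 then 1 else 0) ≤ L.length * 2 := by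
    calc _ = ∑ i : Fin L.length,
          (Finset.univ.filter fun j => (L.get j).2 ∈ (L.get i).1).card := by
            simp only [Finset.card_filter]
      _ ≤ ∑ _i : Fin L.length, 2 := Finset.sum_le_sum fun i _ => hdeg i
      _ = _ := by simp
  have htot : ∑ i : Fin L.length, ∑ j : Fin L.length, 1 ≤
      ∑ i : Fin L.length, ∑ j : Fin L.length, ((if (L.get j).2 ∈ (L.get i).1 then 1 else 0) +
        (if (L.get i).2 ∈ (L.get j).1 then 1 else 0) + (if i = j then 1 else 0)) := by
    refine Finset.sum_le_sum fun i _ => Finset.sum_le_sum fun j _ => ?_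
    by_cases hij : i = j
    · simp [hij]
    · rcases hc i j hij with h' | h'
      · rw [if_pos h']; omega
      · rw [if_pos h']; omega
  simp only [Finset.sum_add_distrib] at htot
  rw [Finset.sum_comm (f := fun i j : Fin L.length =>
    if (L.get i).2 ∈ (L.get j).1 then 1 else 0)] at htot
  have hdiag : ∑ i : Fin L.length, ∑ j : Fin L.length, (if i = j then 1 else 0) = L.length := by
    simp
  have hone : ∑ i : Fin L.length, ∑ j : Fin L.length, 1 = L.length * L.length := by simp
  rw [hdiag, hone] at htot
  by_contra hlt
  nlinarith

/-- The edges of `w` that enter its letters. -/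
def inEdges (T : Finset Atoms) : List (Letter Atoms) → List (Finset Atoms × Atoms)
  | [] => []
  | α :: w => (T, α.1) :: inEdges α.2.1 w

theorem edges_append (T : Finset Atoms) (u v : List (Letter Atoms)) (p : Atoms) :
    edges T (u ++ v) p = inEdges T u ++ edges (lastTarget T u) v p := by
  induction u generalizing T with
  | nil => rfl
  | cons α u ih => simp [edges, inEdges, lastTarget, ih]

theorem length_inEdges (T : Finset Atoms) (w : List (Letter Atoms)) :
    (inEdges T w).length = w.length := by
  induction w generalizing T with
  | nil => rfl
  | cons α w ih => simp [inEdges, ih]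

theorem exists_of_mem_inEdges {T : Finset Atoms} {w : List (Letter Atoms)}
    {e : Finset Atoms × Atoms} (he : e ∈ inEdges T w) :
    ∃ x γ z, w = x ++ γ :: z ∧ e = (lastTarget T x, γ.1) := by
  induction w generalizing T with
  | nil => simp [inEdges] at he
  | cons α w ih =>
    rcases List.mem_cons.1 he with rfl | he
    · exact ⟨[], α, w, rfl, rfl⟩
    · obtain ⟨x, γ, z, rfl, rfl⟩ := ih he
      exact ⟨α :: x, γ, z, rfl, rfl⟩

/-- The two edges that can be crossed enter `β` and `γ`; crossing them closes `β :: y` into a loop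
and joins `x` directly to `γ`. -/
theorem exists_crossing {T : Finset Atoms} {w : List (Letter Atoms)}
    (h : ¬ (inEdges T w).Pairwise Conflict) :
    ∃ x β y γ z, w = x ++ β :: (y ++ γ :: z) ∧ γ.1 ∉ lastTarget T x ∧
      β.1 ∉ lastTarget β.2.1 y := by
  induction w generalizing T with
  | nil => simp [inEdges] at h
  | cons α w ih =>
    rw [inEdges, List.pairwise_cons, not_and_or] at h
    rcases h with h | h
    · push Not at h
      obtain ⟨e, he, hc⟩ := h
      obtain ⟨y, γ, z, rfl, rfl⟩ := exists_of_mem_inEdges he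
      simp only [Conflict, not_or] at hc
      exact ⟨[], α, y, γ, z, rfl, hc⟩
    · obtain ⟨x, β, y, γ, z, rfl, hc⟩ := ih h
      exact ⟨α :: x, β, y, γ, z, rfl, hc⟩

/-- From a stretch of six letters of a word, a loop can be cut out. -/
theorem exists_cut [DecidableEq Atoms] {T : Finset Atoms} (hT : T.card ≤ 2)
    {u v : List (Letter Atoms)} {p : Atoms} (hu : 6 ≤ u.length) (h : Leads T (u ++ v) p) :
    ∃ u' q, List.Perm u (u' ++ toWord q) ∧ IsLoop q ∧ Leads T (u' ++ v) p ∧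
      lastTarget T u' = lastTarget T u := by
  have hnp : ¬ (inEdges T u).Pairwise Conflict := by
    intro hp
    have := length_le_five_of_pairwise_conflict (L := inEdges T u) (fun e he => by
      have he' : e ∈ edges T (u ++ v) p := by
        rw [edges_append]; exact List.mem_append_left _ he
      exact ⟨h e he', card_fst_le_of_mem_edges hT he'⟩) hp
    rw [length_inEdges] at this
    omega
  obtain ⟨x, β, y, γ, z, rfl, h₁, h₂⟩ := exists_crossing hnp
  simp only [List.append_assoc, List.cons_append, leads_append_cons] at h
  refine ⟨x ++ γ :: z, (β, y), ?_, h.2.1.change h₂, ?_, ?_⟩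
  · simp only [toWord, List.append_assoc]
    refine List.Perm.append_left x ?_
    rw [← List.cons_append]
    exact List.perm_append_comm
  · simp only [List.append_assoc, List.cons_append, leads_append_cons]
    exact ⟨h.1.change h₁, h.2.2⟩
  · simp [lastTarget_append, lastTarget]

/-- Bounded loops can be cut out of a word until it is short, without touching given edges. -/
theorem exists_reduction [DecidableEq Atoms] {T : Finset Atoms} (hT : T.card ≤ 2)
    {w : List (Letter Atoms)} {p : Atoms} (hw : Leads T w p) {F : List (Finset Atoms × Atoms)}
    (hF : F.Sublist (edges T w p)) :
    ∃ u v, ∃ qs : List (Letter Atoms × List (Letter Atoms)),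
      w.Perm (u ++ v ++ (qs.map toWord).flatten) ∧ Leads T (u ++ v) p ∧
      F.Sublist (edges (lastTarget T u) v p) ∧ u.length ≤ 5 ∧ v.length ≤ 6 * F.length ∧
      ∀ q ∈ qs, IsLoop q ∧ q.2.length ≤ 5 := by
  induction w generalizing T F with
  | nil => exact ⟨[], [], [], by simp, hw, hF, by simp, by simp, by simp⟩
  | cons α w ih =>
    rw [leads_cons] at hw
    rw [edges] at hF
    rcases List.sublist_cons_iff.1 hF with hF | ⟨F', rfl, hF'⟩
    · obtain ⟨u, v, qs, hperm, hl, hF, hu, hv, hq⟩ := ih α.2.2.le hw.2 hF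
      have hl' : Leads T ((α :: u) ++ v) p := leads_cons.2 ⟨hw.1, hl⟩
      -- The prefix `u` is a buffer of letters entered by unprotected edges. It is cut when it
      -- reaches six letters, and the cut keeps its last target, hence the edge leaving it.
      by_cases hlen : u.length ≤ 4
      · exact ⟨α :: u, v, qs, by simpa using hperm, hl', hF, by simp; omega, hv, hq⟩
      · obtain ⟨u', q, hp, hloop, hl'', hlast⟩ := exists_cut hT (by simp; omega) hl'
        have hlen' := hp.length_eq
        simp only [toWord, List.length_append, List.length_cons] at hlen'
        have hq2 : q.2.length ≤ 5 := by omega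
        refine ⟨u', v, q :: qs, ?_, hl'', by rw [hlast]; exact hF, by omega, hv, ?_⟩
        · refine (List.Perm.cons α hperm).trans ?_
          simp only [List.map_cons, List.flatten_cons, List.append_assoc]
          rw [← List.cons_append]
          refine (List.Perm.append_right _ hp).trans ?_
          rw [List.append_assoc]
          refine List.Perm.append_left u' ?_
          rw [← List.append_assoc, ← List.append_assoc]
          exact List.Perm.append_right _ List.perm_append_comm
        · intro q' hq'
          rcases List.mem_cons.1 hq' with rfl | hq'
          · exact ⟨hloop, hq2⟩
          · exact hq q' hq'
    -- A protected edge moves its letter and the buffer into `v` and empties the buffer: six letters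
    -- at most per protected edge.
    · obtain ⟨u, v, qs, hperm, hl, hF, hu, hv, hq⟩ := ih α.2.2.le hw.2 hF'
      refine ⟨[], α :: (u ++ v), qs, by simpa using hperm, leads_cons.2 ⟨hw.1, hl⟩, ?_, by simp,
        by simp; omega, hq⟩
      simp only [lastTarget, edges, edges_append]
      exact List.Sublist.cons_cons _ (hF.trans (List.sublist_append_right _ _))

/-! ### Inserting loops into a word. -/

/-- Inserting a loop at an edge destroys no other edge. -/
theorem exists_insert {T : Finset Atoms} {w : List (Letter Atoms)} {p : Atoms}
    (hw : Leads T w p) {q : Letter Atoms × List (Letter Atoms)} (hq : IsLoop q)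
    {e : Finset Atoms × Atoms} (he : e ∈ edges T w p) (h₁ : q.1.1 ∉ e.1)
    (h₂ : e.2 ∉ lastTarget q.1.2.1 q.2) :
    ∃ w', w'.Perm (w ++ toWord q) ∧ Leads T w' p ∧
      ∀ P : Finset Atoms × Atoms → Bool, (edges T w p).countP P ≤ (edges T w' p).countP P + 1 := by
  induction w generalizing T with
  | nil =>
    simp only [edges, List.mem_singleton] at he
    subst he
    refine ⟨toWord q, by simp, leads_cons.2 ⟨h₁, hq.change h₂⟩, fun P => ?_⟩
    exact (List.countP_le_length.trans (by simp [edges]))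
  | cons α w ih =>
    rw [leads_cons] at hw
    rw [edges] at he
    rcases List.mem_cons.1 he with rfl | he
    · refine ⟨toWord q ++ α :: w, List.perm_append_comm, ?_, fun P => ?_⟩
      · rw [toWord, List.cons_append, leads_cons, leads_append_cons]
        exact ⟨h₁, hq.change h₂, hw.2⟩
      · rw [edges_append_cons, edges, List.countP_append, List.countP_cons]
        split_ifs <;> omega
    · obtain ⟨w', hp, hl, hc⟩ := ih hw.2 he
      refine ⟨α :: w', hp.cons α, leads_cons.2 ⟨hw.1, hl⟩, fun P => ?_⟩
      simp only [edges, List.countP_cons]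
      have := hc P
      omega

/-- A loop leads back to the source of its head, so it can be put right before any occurrence of
that source, without touching the target that follows. -/
theorem exists_insert_source {T : Finset Atoms} {p : Atoms} {w : List (Letter Atoms)}
    (hw : Leads T w p) {q : Letter Atoms × List (Letter Atoms)} (hq : IsLoop q)
    (hs : q.1.1 ∈ w.map Prod.fst ++ [p]) :
    ∃ w', w'.Perm (w ++ toWord q) ∧ Leads T w' p := by
  obtain ⟨β, l⟩ := q
  rcases List.mem_append.1 hs with hs | hs
  · obtain ⟨α, hα, hαβ⟩ := List.mem_map.1 hs
    obtain ⟨u, v, rfl⟩ := List.append_of_mem hα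
    rw [leads_append_cons] at hw
    refine ⟨u ++ β :: (l ++ α :: v), ?_, ?_⟩
    · rw [List.append_assoc, ← List.cons_append]
      exact List.Perm.append_left _ List.perm_append_comm
    · simp only [leads_append_cons]
      have hq' : Leads β.2.1 l β.1 := hq
      exact ⟨hαβ ▸ hw.1, hαβ ▸ hq', hw.2⟩
  · rw [List.mem_singleton] at hs
    simp only at hs
    subst hs
    exact ⟨w ++ β :: l, List.Perm.refl _, leads_append_cons.2 ⟨hw, hq⟩⟩

variable [DecidableEq Atoms]

/-- Whatever the target `T`, a loop that starts at the source `y` and ends with `T` can be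
inserted at five or more of the edges in `E`. -/
def Roomy (E : List (Finset Atoms × Atoms)) (y : Atoms) : Prop :=
  ∀ T : Finset Atoms, T.card ≤ 2 → 5 ≤ E.countP fun e => y ∉ e.1 ∧ e.2 ∉ T

theorem Roomy.mono {E F : List (Finset Atoms × Atoms)} (h : E.Sublist F) {y : Atoms}
    (hy : Roomy E y) : Roomy F y := fun T hT => (hy T hT).trans (h.countP_le)

/-- Merging loops at their heads, until at most five are left. -/
theorem exists_merge (R : Atoms → Prop) (qs : List (Letter Atoms × List (Letter Atoms)))
    (hqs : ∀ q ∈ qs, IsLoop q ∧ R q.1.1) :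
    ∃ ds : List (Letter Atoms × List (Letter Atoms)),
      (qs.map toWord).flatten.Perm (ds.map toWord).flatten ∧ ds.length ≤ 5 ∧
      ∀ d ∈ ds, IsLoop d ∧ R d.1.1 := by
  induction hn : qs.length using Nat.strong_induction_on generalizing qs with
  | _ n ih =>
    by_cases hp : (qs.map fun q => (lastTarget q.1.2.1 q.2, q.1.1)).Pairwise Conflict
    · refine ⟨qs, List.Perm.refl _, ?_, hqs⟩
      have := length_le_five_of_pairwise_conflict (fun e he => by
        obtain ⟨q, hq, rfl⟩ := List.mem_map.1 he
        exact ⟨(hqs q hq).1.notMem_lastTarget, card_lastTarget_le q.1.2.2.le q.2⟩) hp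
      simpa using this
    · rw [List.pairwise_map] at hp
      have : ∃ q r s, qs.Perm (q :: r :: s) ∧
          ¬ Conflict (lastTarget q.1.2.1 q.2, q.1.1) (lastTarget r.1.2.1 r.2, r.1.1) := by
        clear ih hqs hn
        induction qs with
        | nil => simp at hp
        | cons q t iht =>
          rw [List.pairwise_cons, not_and_or] at hp
          rcases hp with hp | hp
          · push Not at hp
            obtain ⟨r, hr, hc⟩ := hp
            exact ⟨q, r, t.erase r, (List.perm_cons_erase hr).cons q, hc⟩
          · obtain ⟨q', r, s, hs, hc⟩ := iht hp
            exact ⟨q', r, q :: s, (hs.cons q).trans (by grind), hc⟩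
      obtain ⟨q, r, s, hs, hc⟩ := this
      simp only [Conflict, not_or] at hc
      have hq := hqs q (hs.mem_iff.2 (by simp))
      have hr := hqs r (hs.mem_iff.2 (by simp))
      have hlen := hs.length_eq
      simp only [List.length_cons] at hlen
      -- Two loops without conflict concatenate to one loop, which keeps the head of the first and
      -- therefore the property `R`.
      obtain ⟨ds, hds, h5, hd⟩ := ih (s.length + 1) (by omega) ((q.1, q.2 ++ toWord r) :: s)
        (by
          intro d hd
          rcases List.mem_cons.1 hd with rfl | hd
          · exact ⟨leads_append_cons.2 ⟨hq.1.change hc.1, hr.1.change hc.2⟩, hq.2⟩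
          · exact hqs d (hs.mem_iff.2 (by simp [hd]))) (by simp)
      refine ⟨ds, ?_, h5, hd⟩
      refine (List.Perm.flatten (hs.map toWord)).trans (List.Perm.trans ?_ hds)
      simp [toWord]

/-- Each insertion uses up at most one suitable edge of every remaining loop, so having as many
suitable edges as loops is preserved. -/
theorem exists_insert_all {T : Finset Atoms} {p : Atoms}
    (ds : List (Letter Atoms × List (Letter Atoms))) {w : List (Letter Atoms)} (hw : Leads T w p)
    (hds : ∀ d ∈ ds, IsLoop d ∧ ∀ S : Finset Atoms, S.card ≤ 2 →
      ds.length ≤ (edges T w p).countP fun e => d.1.1 ∉ e.1 ∧ e.2 ∉ S) :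
    ∃ w', w'.Perm (w ++ (ds.map toWord).flatten) ∧ Leads T w' p := by
  induction ds generalizing w with
  | nil => exact ⟨w, by simp, hw⟩
  | cons d ds ih =>
    have hd := hds d (by simp)
    have hpos := hd.2 (lastTarget d.1.2.1 d.2) (card_lastTarget_le d.1.2.2.le _)
    obtain ⟨e, he, hPe⟩ := List.countP_pos_iff.1
      (lt_of_lt_of_le (Nat.succ_pos ds.length) hpos)
    simp only [decide_eq_true_eq] at hPe
    obtain ⟨w', hp, hl, hc⟩ := exists_insert hw hd.1 he hPe.1 hPe.2
    obtain ⟨w'', hp', hl'⟩ := ih hl (fun d' hd' => by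
      have h' := hds d' (List.mem_cons_of_mem _ hd')
      refine ⟨h'.1, fun S hS => ?_⟩
      have h₁ := h'.2 S hS
      have h₂ := hc fun e => decide (d'.1.1 ∉ e.1 ∧ e.2 ∉ S)
      simp only [List.length_cons] at h₁
      omega)
    refine ⟨w'', hp'.trans ?_, hl'⟩
    simpa using List.Perm.append_right _ hp

theorem exists_insert_source_all {T : Finset Atoms} {p : Atoms}
    (qs : List (Letter Atoms × List (Letter Atoms))) {w : List (Letter Atoms)} (hw : Leads T w p)
    (hqs : ∀ q ∈ qs, IsLoop q ∧ q.1.1 ∈ w.map Prod.fst ++ [p]) :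
    ∃ w', w'.Perm (w ++ (qs.map toWord).flatten) ∧ Leads T w' p := by
  induction qs generalizing w with
  | nil => exact ⟨w, by simp, hw⟩
  | cons q qs ih =>
    have hq := hqs q (by simp)
    obtain ⟨w', hp, hl⟩ := exists_insert_source hw hq.1 hq.2
    obtain ⟨w'', hp', hl'⟩ := ih hl (fun r hr => by
      have h' := hqs r (List.mem_cons_of_mem _ hr)
      refine ⟨h'.1, ?_⟩
      have := (hp.map Prod.fst).mem_iff (a := r.1.1)
      simp only [List.mem_append, List.map_append] at this h' ⊢
      tauto)
    refine ⟨w'', hp'.trans ?_, hl'⟩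
    simpa using List.Perm.append_right _ hp

/-- The loops that may be added any number of times to the word `w` leading from `T` to `p`. -/
def IsPeriod (T : Finset Atoms) (w : List (Letter Atoms)) (p : Atoms)
    (q : Letter Atoms × List (Letter Atoms)) : Prop :=
  IsLoop q ∧ (q.1.1 ∈ (edges T w p).map Prod.snd ∨ Roomy (edges T w p) q.1.1)

/-- The roomy loops go in first, merged to at most five. The others follow, since insertions never
remove a source. -/
theorem exists_insert_periods {T : Finset Atoms} {p : Atoms}
    (qs : List (Letter Atoms × List (Letter Atoms))) {w : List (Letter Atoms)} (hw : Leads T w p)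
    (hqs : ∀ q ∈ qs, IsPeriod T w p q) :
    ∃ w', w'.Perm (w ++ (qs.map toWord).flatten) ∧ Leads T w' p := by
  classical
  let hit : Letter Atoms × List (Letter Atoms) → Bool :=
    fun q => q.1.1 ∈ (edges T w p).map Prod.snd
  obtain ⟨ds, hds, h5, hd⟩ := exists_merge (Roomy (edges T w p))
    (qs.filter fun q => !hit q) (fun q hq => by
      have hq' := List.mem_filter.1 hq
      refine ⟨(hqs q hq'.1).1, (hqs q hq'.1).2.resolve_left ?_⟩
      simpa [hit] using hq'.2)
  obtain ⟨w₁, hp₁, hl₁⟩ := exists_insert_all ds hw fun d hd' =>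
    ⟨(hd d hd').1, fun S hS => h5.trans ((hd d hd').2 S hS)⟩
  obtain ⟨w₂, hp₂, hl₂⟩ := exists_insert_source_all (qs.filter hit) hl₁ (fun q hq => by
      have hq' := List.mem_filter.1 hq
      refine ⟨(hqs q hq'.1).1, ?_⟩
      have h' : q.1.1 ∈ (edges T w p).map Prod.snd := by simpa [hit] using hq'.2
      rw [map_snd_edges] at h'
      have := (hp₁.map Prod.fst).mem_iff (a := q.1.1)
      simp only [List.mem_append, List.map_append] at this h' ⊢
      tauto)
  refine ⟨w₂, hp₂.trans ((List.Perm.append_right _ hp₁).trans ?_), hl₂⟩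
  rw [List.append_assoc]
  refine List.Perm.append_left _ ?_
  refine (List.Perm.append_right _ hds.symm).trans ?_
  rw [← List.flatten_append, ← List.map_append]
  refine List.Perm.flatten (List.Perm.map _ ?_)
  exact List.perm_append_comm.trans (List.filter_append_perm hit qs)

/-! ### Bounded cores. -/

/-- A bounded choice of edges such that every source is the source of a chosen edge or has room
among the chosen edges. -/
theorem exists_sublist_roomy (E : List (Finset Atoms × Atoms)) (hE : ∀ e ∈ E, e.1.card ≤ 2) :
    ∃ F : List (Finset Atoms × Atoms), F.Sublist E ∧ F.length ≤ 21 ∧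
      ∀ e ∈ E, e.2 ∈ F.map Prod.snd ∨ Roomy F e.2 := by
  -- One edge for each source.
  obtain ⟨G, hGE, hnd, hG⟩ : ∃ G : List (Finset Atoms × Atoms), G.Sublist E ∧
      (G.map Prod.snd).Nodup ∧ ∀ e ∈ E, e.2 ∈ G.map Prod.snd := by
    clear hE
    induction E with
    | nil => exact ⟨[], by simp⟩
    | cons e E ih =>
      obtain ⟨G, hGE, hnd, hG⟩ := ih
      by_cases he : e.2 ∈ G.map Prod.snd
      · exact ⟨G, hGE.cons e, hnd, fun f hf => (List.mem_cons.1 hf).elim (fun h => h ▸ he) (hG f)⟩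
      · exact ⟨e :: G, hGE.cons_cons e, List.nodup_cons.2 ⟨he, hnd⟩, fun f hf =>
          (List.mem_cons.1 hf).elim (fun h => by simp [h])
            fun h => List.mem_cons_of_mem _ (hG f h)⟩
  by_cases hlen : G.length ≤ 21
  · exact ⟨G, hGE, hlen, fun e he => Or.inl (hG e he)⟩
  -- Of seven edges with distinct sources, a target `T` excludes at most two, leaving the five that
  -- `Roomy` asks for. The seven sources and the at most 14 atoms of their targets account for the
  -- bound 21; a source outside this set `V` avoids all seven targets.
  have hH : (G.take 7).length = 7 := by simp; omega
  set H := G.take 7 with hHdef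
  have hHG : H.Sublist G := List.take_sublist _ _
  have hHnd : (H.map Prod.snd).Nodup := hnd.sublist (hHG.map _)
  let U : Finset Atoms := H.toFinset.biUnion Prod.fst
  have hU : U.card ≤ 14 := by
    calc U.card ≤ H.toFinset.card * 2 := Finset.card_biUnion_le_card_mul _ _ _ fun e he =>
          hE e ((hHG.trans hGE).subset (List.mem_toFinset.1 he))
      _ ≤ 7 * 2 := Nat.mul_le_mul_right _ ((List.toFinset_card_le H).trans hH.le)
  let V : Finset Atoms := (H.map Prod.snd).toFinset ∪ U
  have hV : V.card ≤ 21 := by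
    refine (Finset.card_union_le _ _).trans ?_
    have := (List.toFinset_card_le (H.map Prod.snd))
    rw [List.length_map] at this
    omega
  let F := G.filter fun e => e.2 ∈ V
  have hFG : F.Sublist G := List.filter_sublist
  have hHF : H.Sublist F := by
    have hself : H.filter (fun e => decide (e.2 ∈ V)) = H := by
      rw [List.filter_eq_self]
      intro e he
      have : e.2 ∈ V :=
        Finset.mem_union_left _ (List.mem_toFinset.2 (List.mem_map_of_mem (f := Prod.snd) he))
      simpa using this
    rw [← hself]
    exact hHG.filter _
  refine ⟨F, hFG.trans hGE, ?_, fun e he => ?_⟩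
  · have h₁ : (F.map Prod.snd).toFinset ⊆ V := by
      intro y hy
      obtain ⟨e, he, rfl⟩ := List.mem_map.1 (List.mem_toFinset.1 hy)
      simpa using (List.mem_filter.1 he).2
    have h₂ := List.toFinset_card_of_nodup (hnd.sublist (hFG.map Prod.snd))
    rw [List.length_map] at h₂
    rw [← h₂]
    exact (Finset.card_le_card h₁).trans hV
  · by_cases hy : e.2 ∈ V
    · left
      obtain ⟨f, hf, hfe⟩ := List.mem_map.1 (hG e he)
      exact List.mem_map.2 ⟨f, List.mem_filter.2 ⟨hf, by simpa [hfe] using hy⟩, hfe⟩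
    · right
      refine Roomy.mono hHF fun T hT => ?_
      have hsplit := List.length_eq_countP_add_countP
        (fun f : Finset Atoms × Atoms => decide (f.2 ∉ T)) (l := H)
      have hle : H.countP (fun f => decide (¬ decide (f.2 ∉ T) = true)) ≤ 2 := by
        rw [List.countP_eq_length_filter]
        have h₂ := List.toFinset_card_of_nodup (hHnd.sublist ((List.filter_sublist
          (p := fun f : Finset Atoms × Atoms => decide (¬ decide (f.2 ∉ T) = true))).map Prod.snd))
        rw [List.length_map] at h₂
        rw [← h₂]
        refine (Finset.card_le_card fun y hy => ?_).trans hT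
        obtain ⟨f, hf, rfl⟩ := List.mem_map.1 (List.mem_toFinset.1 hy)
        simpa using (List.mem_filter.1 hf).2
      have hmono : H.countP (fun f => decide (f.2 ∉ T)) ≤
          H.countP (fun f => decide (e.2 ∉ f.1 ∧ f.2 ∉ T)) := by
        refine List.countP_mono_left fun f hf hfT => ?_
        have : e.2 ∉ f.1 := fun hef => hy (Finset.mem_union_right _
          (Finset.mem_biUnion.2 ⟨f, List.mem_toFinset.2 hf, hef⟩))
        simpa [this] using hfT
      omega

/-- Every word decomposes into a bounded core and bounded periods of the core. -/
theorem exists_core {T : Finset Atoms} {α : Letter Atoms}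
    {w : List (Letter Atoms)} {p : Atoms} (hw : Leads T (α :: w) p) :
    ∃ k, ∃ qs : List (Letter Atoms × List (Letter Atoms)),
      (α :: w).Perm (α :: k ++ (qs.map toWord).flatten) ∧ Leads T (α :: k) p ∧
      k.length ≤ 131 ∧ ∀ q ∈ qs, IsPeriod T (α :: k) p q ∧ q.2.length ≤ 5 := by
  rw [leads_cons] at hw
  obtain ⟨F, hFE, hFlen, hF⟩ := exists_sublist_roomy (edges α.2.1 w p)
    fun e he => card_fst_le_of_mem_edges α.2.2.le he
  obtain ⟨u, v, qs, hperm, hl, hFs, hu, hv, hq⟩ := exists_reduction α.2.2.le hw.2 hFE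
  have hFk : F.Sublist (edges T (α :: (u ++ v)) p) := by
    rw [edges, edges_append]
    exact (hFs.trans (List.sublist_append_right _ _)).cons _
  -- The bound is `131 = 5 + 6 * 21`. The first letter `α` is never cut, so the core is nonempty.
  refine ⟨u ++ v, qs, hperm.cons α, leads_cons.2 ⟨hw.1, hl⟩, by simp; omega, fun q hqm => ?_⟩
  refine ⟨⟨(hq q hqm).1, ?_⟩, (hq q hqm).2⟩
  have hsrc : q.1.1 ∈ (edges α.2.1 w p).map Prod.snd := by
    rw [map_snd_edges]
    refine List.mem_append_left _ ((hperm.map Prod.fst).mem_iff.2 (List.mem_map_of_mem ?_))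
    exact List.mem_append_right _ (List.mem_flatten.2
      ⟨toWord q, List.mem_map_of_mem hqm, by simp [toWord]⟩)
  obtain ⟨e, he, hee⟩ := List.mem_map.1 hsrc
  rw [← hee]
  exact (hF e he).imp (fun h => (hFk.map Prod.snd).subset h) (Roomy.mono hFk)

theorem mem_antiPaths_iff {a b c : Atoms} {w : List (Letter Atoms)} :
    w ∈ antiPaths b c a ↔ w ≠ [] ∧ Leads {b, c} w a := by
  have key : ∀ (α : Letter Atoms) (w : List (Letter Atoms)), Leads α.2.1 w a ↔
      (α :: w).IsChain (fun α β => β.1 ∉ α.2) ∧ ∀ β ∈ (α :: w).getLast?, a ∉ β.2 := by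
    intro α w
    induction w generalizing α with
    | nil => simp [leads_nil, Set.powersetCard.mem_coe_iff]
    | cons β w ih =>
      rw [leads_cons, ih, List.isChain_cons_cons, List.getLast?_cons_cons, and_assoc,
        Set.powersetCard.mem_coe_iff]
  cases w with
  | nil => simp [antiPaths]
  | cons α w =>
    rw [leads_cons, key]
    refine ⟨fun h => ⟨h.1, by simpa using h.2.1 α rfl, h.2.2⟩, fun h => ⟨h.1, fun β hβ => ?_, h.2.2⟩⟩
    cases hβ
    simpa using h.2.1

end Words

/-! ### Renaming of atoms and orbit-finiteness. -/

/-- A monoid acts on words by acting on their letters. -/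
instance wordMulAction {G : Type u} {A : Type v} [Monoid G] [MulAction G A] :
    MulAction G (List A) where
  smul g w := w.map (g • ·)
  one_smul w := by
    change w.map (fun x => (1 : G) • x) = w
    simp
  mul_smul g h w := by
    change w.map (fun x => (g * h) • x) = (w.map (h • ·)).map (g • ·)
    simp [mul_smul, Function.comp_def]

theorem word_smul_eq {G : Type u} {A : Type v} [Monoid G] [MulAction G A] (g : G) (w : List A) :
    g • w = w.map (g • ·) := rfl

section Renaming

variable {Atoms : Type u}

theorem pair_eq_of_toWord_eq {q r : Letter Atoms × List (Letter Atoms)}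
    (h : toWord q = toWord r) : q = r :=
  Prod.ext (List.cons.inj h).1 (List.cons.inj h).2

/-- The inverse of a permutation fixing `S` pointwise also fixes it, so inclusion suffices. -/
theorem smul_set_eq {I : Type v} [MulAction (Equiv.Perm Atoms) I] {J : Set I} {S : Finset Atoms}
    (hJ : ∀ π : Equiv.Perm Atoms, (∀ x ∈ S, π x = x) → ∀ i ∈ J, π • i ∈ J)
    {π : Equiv.Perm Atoms} (hπ : ∀ x ∈ S, π x = x) : π • J = J := by
  refine Set.Subset.antisymm ?_ fun i hi => ?_
  · rintro _ ⟨i, hi, rfl⟩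
    exact hJ π hπ i hi
  · refine Set.mem_smul_set_iff_inv_smul_mem.2 (hJ π⁻¹ (fun x hx => ?_) i hi)
    rw [Equiv.Perm.inv_eq_iff_eq]
    exact (hπ x hx).symm

theorem sum_parikh (qs : List (Letter Atoms × List (Letter Atoms))) :
    (qs.map fun q => parikh (toWord q)).sum = parikh (qs.map toWord).flatten := by
  induction qs with
  | nil => rfl
  | cons q qs ih =>
    rw [List.map_cons, List.sum_cons, ih]
    rfl

theorem finite_words (A : Finset Atoms) (n : ℕ) :
    {w : List (Letter Atoms) | w.length ≤ n ∧ ∀ α ∈ w, α.1 ∈ A ∧ α.2.1 ⊆ A}.Finite := by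
  have hfin : {α : Letter Atoms | α.1 ∈ A ∧ α.2.1 ⊆ A}.Finite := by
    refine Set.Finite.of_finite_image (f := fun α => (α.1, α.2.1)) ?_ ?_
    · refine ((A.finite_toSet).prod (A.powerset.finite_toSet)).subset ?_
      rintro _ ⟨α, hα, rfl⟩
      exact ⟨hα.1, Finset.mem_coe.2 (Finset.mem_powerset.2 hα.2)⟩
    · intro α _ β _ h
      simp only [Prod.mk.injEq] at h
      exact Prod.ext h.1 (Subtype.ext h.2)
  have : Finite {α : Letter Atoms | α.1 ∈ A ∧ α.2.1 ⊆ A} := hfin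
  refine ((List.finite_length_le {α : Letter Atoms | α.1 ∈ A ∧ α.2.1 ⊆ A} n).image
    (List.map Subtype.val)).subset ?_
  intro w hw
  refine ⟨w.attach.map fun α => ⟨α.1, hw.2 α.1 α.2⟩, ?_, ?_⟩
  · change (List.map _ w.attach).length ≤ n
    rw [List.length_map, List.length_attach]
    exact hw.1
  · rw [List.map_map]
    exact List.attach_map_subtype_val w

variable [DecidableEq Atoms]

theorem toWord_smul (π : Equiv.Perm Atoms) (q : Letter Atoms × List (Letter Atoms)) :
    toWord (π • q) = (toWord q).map (π • ·) := rfl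

theorem edges_smul (π : Equiv.Perm Atoms) (T : Finset Atoms) (w : List (Letter Atoms))
    (p : Atoms) : edges (π • T) (w.map (π • ·)) (π • p) = (edges T w p).map (π • ·) := by
  induction w generalizing T with
  | nil => rfl
  | cons α w ih =>
    simp only [List.map_cons, edges, ← ih]
    rw [← Set.powersetCard.coe_smul]
    rfl

theorem leads_smul (π : Equiv.Perm Atoms) {T : Finset Atoms} {w : List (Letter Atoms)}
    {p : Atoms} : Leads (π • T) (w.map (π • ·)) (π • p) ↔ Leads T w p := by
  simp only [Leads, edges_smul, List.forall_mem_map, Prod.smul_snd, Prod.smul_fst,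
    Finset.smul_mem_smul_finset_iff]

theorem isLoop_smul (π : Equiv.Perm Atoms) {q : Letter Atoms × List (Letter Atoms)} :
    IsLoop (π • q) ↔ IsLoop q := by
  have := leads_smul π (T := q.1.2.1) (w := q.2) (p := q.1.1)
  rw [← Set.powersetCard.coe_smul] at this
  exact this

theorem roomy_smul (π : Equiv.Perm Atoms) {E : List (Finset Atoms × Atoms)} {y : Atoms} :
    Roomy (E.map (π • ·)) (π • y) ↔ Roomy E y := by
  have key : ∀ T : Finset Atoms,
      ((E.map (π • ·)).countP fun e => π • y ∉ e.1 ∧ e.2 ∉ π • T) =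
        E.countP fun e => y ∉ e.1 ∧ e.2 ∉ T := by
    intro T
    rw [List.countP_map]
    simp only [Function.comp_def, Prod.smul_snd, Prod.smul_fst,
      Finset.smul_mem_smul_finset_iff]
  constructor
  · intro h T hT
    rw [← key T]
    exact h _ (by rwa [Finset.card_smul_finset])
  · intro h T hT
    rw [← smul_inv_smul π T, key]
    exact h _ (by rwa [Finset.card_smul_finset])

theorem isPeriod_smul (π : Equiv.Perm Atoms) {T : Finset Atoms} {w : List (Letter Atoms)}
    {p : Atoms} {q : Letter Atoms × List (Letter Atoms)} :
    IsPeriod (π • T) (w.map (π • ·)) (π • p) (π • q) ↔ IsPeriod T w p q := by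
  have h : (π • q).1.1 ∈ (edges (π • T) (w.map (π • ·)) (π • p)).map Prod.snd ↔
      q.1.1 ∈ (edges T w p).map Prod.snd := by
    rw [edges_smul, List.map_map, show Prod.snd ∘ (fun e : Finset Atoms × Atoms => π • e) =
      (π • ·) ∘ Prod.snd from rfl, ← List.map_map]
    exact List.mem_map_of_injective (MulAction.injective π)
  rw [IsPeriod, IsPeriod, isLoop_smul, h, edges_smul]
  exact and_congr_right fun _ => or_congr_right (roomy_smul π)

theorem exists_atoms (w : List (Letter Atoms)) :
    ∃ A : Finset Atoms, A.card ≤ 3 * w.length ∧ ∀ α ∈ w, α.1 ∈ A ∧ α.2.1 ⊆ A := by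
  induction w with
  | nil => exact ⟨∅, by simp⟩
  | cons α w ih =>
    obtain ⟨A, hA, h⟩ := ih
    refine ⟨insert α.1 α.2.1 ∪ A, ?_, ?_⟩
    · have h₁ := Finset.card_union_le (insert α.1 α.2.1) A
      have h₂ := Finset.card_insert_le α.1 α.2.1
      have h₃ : α.2.1.card = 2 := α.2.2
      rw [List.length_cons]
      omega
    · intro β hβ
      rcases List.mem_cons.1 hβ with rfl | hβ
      · exact ⟨by simp, fun x hx => by simp [hx]⟩
      · exact ⟨Finset.mem_union_right _ (h β hβ).1,
          (h β hβ).2.trans Finset.subset_union_right⟩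

theorem letter_smul_eq_self {π : Equiv.Perm Atoms} {α : Letter Atoms} {A : Finset Atoms}
    (hπ : ∀ x ∈ A, π • x = x) (hα : α.1 ∈ A ∧ α.2.1 ⊆ A) : π • α = α := by
  refine Prod.ext (hπ _ hα.1) (Subtype.ext ?_)
  rw [Prod.smul_snd, Set.powersetCard.coe_smul]
  have : (α.2.1).image (fun x => π • x) = (α.2.1).image id :=
    Finset.image_congr fun x hx => hπ x (hα.2 hx)
  simpa [Finset.smul_finset_def] using this

theorem finset_smul_eq_self {π : Equiv.Perm Atoms} {A : Finset Atoms}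
    (hπ : ∀ x ∈ A, π • x = x) : π • A = A := by
  have : A.image (fun x => π • x) = A.image id := Finset.image_congr fun x hx => hπ x hx
  simpa [Finset.smul_finset_def] using this

theorem map_smul_eq_self {π : Equiv.Perm Atoms} {w : List (Letter Atoms)} {A : Finset Atoms}
    (hπ : ∀ x ∈ A, π • x = x) (hw : ∀ α ∈ w, α.1 ∈ A ∧ α.2.1 ⊆ A) : w.map (π • ·) = w := by
  calc w.map (π • ·) = w.map id :=
        List.map_congr_left fun α hα => letter_smul_eq_self hπ (hw α hα)
    _ = w := List.map_id w

/-- After enlarging `A` to exactly `n` atoms, transitivity of permutations on `n`-element sets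
applies. -/
theorem exists_smul_subset [Infinite Atoms] {n : ℕ} {A B : Finset Atoms} (hA : A.card ≤ n)
    (hB : B.card = n) : ∃ π : Equiv.Perm Atoms, π • A ⊆ B := by
  obtain ⟨A', hAA', hA'⟩ := Infinite.exists_superset_card_eq A n hA
  have := Set.powersetCard.isPretransitive (α := Atoms) (n := n)
  obtain ⟨π, hπ⟩ := MulAction.exists_smul_eq (Equiv.Perm Atoms)
    (⟨A', hA'⟩ : Set.powersetCard Atoms n) ⟨B, hB⟩
  refine ⟨π, ?_⟩
  have h : π • A' = B := Set.powersetCard.coe_smul.symm.trans (congrArg Subtype.val hπ)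
  rw [← h]
  exact Finset.smul_finset_subset_smul_finset hAA'

/-- A finitely supported set of words of bounded length is orbit-finite. -/
theorem orbitFinite_of_length_le [Infinite Atoms]
    {J : Set (Letter Atoms × List (Letter Atoms))} {S : Finset Atoms} {n : ℕ}
    (hJ : ∀ π : Equiv.Perm Atoms, (∀ x ∈ S, π x = x) → ∀ q ∈ J, π • q ∈ J)
    (hn : ∀ q ∈ J, q.2.length ≤ n) : OrbitFinite Atoms J where
  supported := ⟨S, fun _ hπ => smul_set_eq hJ fun x hx => hπ (Finset.mem_coe.2 hx)⟩
  supported_mem q _ := by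
    obtain ⟨A, -, hA⟩ := exists_atoms (toWord q)
    refine ⟨A, fun π hπ => pair_eq_of_toWord_eq ?_⟩
    rw [toWord_smul]
    exact map_smul_eq_self (fun x hx => hπ (Finset.mem_coe.2 hx)) hA
  finite_orbits := by
    -- A letter has at most three atoms, so every orbit has a representative over the fixed finite
    -- set `B`, and only finitely many bounded words exist there.
    obtain ⟨B, hB⟩ := Infinite.exists_subset_card_eq Atoms (3 * (n + 1))
    have hfin : {q : Letter Atoms × List (Letter Atoms) | (toWord q).length ≤ n + 1 ∧
        ∀ α ∈ toWord q, α.1 ∈ B ∧ α.2.1 ⊆ B}.Finite :=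
      (finite_words B (n + 1)).preimage fun q _ r _ h => pair_eq_of_toWord_eq h
    refine (hfin.image fun q => MulAction.orbit (Equiv.Perm Atoms) q).subset ?_
    rintro _ ⟨q, hq, rfl⟩
    have hlen : (toWord q).length ≤ n + 1 := by
      have := hn q hq
      simpa [toWord] using this
    obtain ⟨A, hAcard, hA⟩ := exists_atoms (toWord q)
    obtain ⟨π, hπ⟩ := exists_smul_subset (hAcard.trans (Nat.mul_le_mul_left 3 hlen)) hB
    refine ⟨π • q, ⟨?_, ?_⟩, MulAction.orbit_eq_iff.2 ⟨π, rfl⟩⟩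
    · rw [toWord_smul, List.length_map]
      exact hlen
    · rw [toWord_smul, List.forall_mem_map]
      intro α hα
      refine ⟨hπ (Finset.smul_mem_smul_finset (hA α hα).1), ?_⟩
      rw [Prod.smul_snd, Set.powersetCard.coe_smul]
      exact (Finset.smul_finset_subset_smul_finset (hA α hα).2).trans hπ

/-! ### The Parikh image as an orbit-finite union. -/

/-- The bounded periods of the word `κ` leading from `T` to `p`. -/
def boundedPeriods (T : Finset Atoms) (p : Atoms) (κ : Letter Atoms × List (Letter Atoms)) :
    Set (Letter Atoms × List (Letter Atoms)) :=
  {q | IsPeriod T (toWord κ) p q ∧ q.2.length ≤ 5}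

/-- The sums of the core `κ` and its bounded periods. -/
def coreSet (T : Finset Atoms) (p : Atoms) (κ : Letter Atoms × List (Letter Atoms)) :
    Set (DataVector (Letter Atoms)) :=
  {parikh (toWord κ)} + sumStar (⋃ q ∈ boundedPeriods T p κ, {parikh (toWord q)})

theorem mem_coreSet {T : Finset Atoms} {p : Atoms} {κ : Letter Atoms × List (Letter Atoms)}
    {x : DataVector (Letter Atoms)} :
    x ∈ coreSet T p κ ↔ ∃ qs : List (Letter Atoms × List (Letter Atoms)),
      (∀ q ∈ qs, q ∈ boundedPeriods T p κ) ∧ x = parikh (toWord κ ++ (qs.map toWord).flatten) := by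
  constructor
  · rintro ⟨_, rfl, _, ⟨l, hl, rfl⟩, rfl⟩
    have : ∃ qs : List (Letter Atoms × List (Letter Atoms)),
        (∀ q ∈ qs, q ∈ boundedPeriods T p κ) ∧ l = qs.map fun q => parikh (toWord q) := by
      induction l with
      | nil => exact ⟨[], by simp⟩
      | cons y l ih =>
        obtain ⟨qs, hqs, rfl⟩ := ih fun z hz => hl z (List.mem_cons_of_mem _ hz)
        have hy := hl y (by simp)
        simp only [Set.mem_iUnion, Set.mem_singleton_iff] at hy
        obtain ⟨q, hq, rfl⟩ := hy
        exact ⟨q :: qs, List.forall_mem_cons.2 ⟨hq, hqs⟩, rfl⟩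
    obtain ⟨qs, hqs, rfl⟩ := this
    exact ⟨qs, hqs, by rw [sum_parikh]; rfl⟩
  · rintro ⟨qs, hqs, rfl⟩
    refine ⟨_, rfl, _, ⟨qs.map fun q => parikh (toWord q), ?_, rfl⟩, by rw [sum_parikh]; rfl⟩
    rw [List.forall_mem_map]
    exact fun q hq => Set.mem_biUnion (hqs q hq) rfl

theorem smul_mem_boundedPeriods {π : Equiv.Perm Atoms} {T : Finset Atoms} {p : Atoms}
    {κ q : Letter Atoms × List (Letter Atoms)} (hT : π • T = T) (hp : π • p = p)
    (hq : q ∈ boundedPeriods T p κ) : π • q ∈ boundedPeriods T p (π • κ) := by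
  refine ⟨?_, ?_⟩
  · rw [toWord_smul]
    have := (isPeriod_smul π).2 hq.1
    rwa [hT, hp] at this
  · have := hq.2
    rwa [Prod.smul_snd, word_smul_eq, List.length_map]

theorem permute_mem_coreSet {π : Equiv.Perm Atoms} {T : Finset Atoms} {p : Atoms}
    {κ : Letter Atoms × List (Letter Atoms)} (hT : π • T = T) (hp : π • p = p)
    {x : DataVector (Letter Atoms)} (hx : x ∈ coreSet T p κ) :
    DataVector.permute π x ∈ coreSet T p (π • κ) := by
  obtain ⟨qs, hqs, rfl⟩ := mem_coreSet.1 hx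
  refine mem_coreSet.2 ⟨qs.map (π • ·), ?_, ?_⟩
  · rw [List.forall_mem_map]
    exact fun q hq => smul_mem_boundedPeriods hT hp (hqs q hq)
  · simp only [DataVector.permute, parikh, Multiset.map_coe, List.map_append, List.map_flatten,
      List.map_map]
    rfl

theorem coreSet_smul {π : Equiv.Perm Atoms} {T : Finset Atoms} {p : Atoms}
    (hT : π • T = T) (hp : π • p = p) (κ : Letter Atoms × List (Letter Atoms)) :
    coreSet T p (π • κ) = DataVector.permute π '' coreSet T p κ := by
  refine Set.Subset.antisymm (fun x hx => ?_) ?_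
  · refine ⟨DataVector.permute π⁻¹ x, ?_, ?_⟩
    · have := permute_mem_coreSet (π := π⁻¹) (inv_smul_eq_iff.2 hT.symm)
        (inv_smul_eq_iff.2 hp.symm) hx
      rwa [inv_smul_smul] at this
    · simp [DataVector.permute, Multiset.map_map]
  · rintro _ ⟨x, hx, rfl⟩
    exact permute_mem_coreSet hT hp hx

/-- The set of bounded periods is supported by `p`, `T` and the atoms of `κ`, so the union under the
star is orbit-finite. -/
theorem isRational_coreSet [Infinite Atoms] (T : Finset Atoms) (p : Atoms)
    (κ : Letter Atoms × List (Letter Atoms)) : IsRational Atoms (coreSet T p κ) := by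
  obtain ⟨A, -, hA⟩ := exists_atoms (toWord κ)
  have hJ : ∀ π : Equiv.Perm Atoms, (∀ x ∈ insert p (T ∪ A), π x = x) →
      ∀ q ∈ boundedPeriods T p κ, π • q ∈ boundedPeriods T p κ := by
    intro π hπ q hq
    have hκ : π • κ = κ := pair_eq_of_toWord_eq (by
      rw [toWord_smul]
      exact map_smul_eq_self (fun x hx => hπ x (by simp [hx])) hA)
    have := smul_mem_boundedPeriods (π := π)
      (finset_smul_eq_self fun x hx => hπ x (by simp [hx])) (hπ p (by simp)) hq
    rwa [hκ] at this
  refine .add _ _ (.singleton _) (.star _ (.iUnion _ _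
    (orbitFinite_of_length_le hJ fun q hq => hq.2) ⟨_, fun π hπ => ⟨smul_set_eq hJ hπ, ?_⟩⟩
    fun q _ => .singleton _))
  intro q _
  rw [Set.image_singleton]
  rfl

/-- The bounded nonempty words leading from `T` to `p`. -/
def cores (T : Finset Atoms) (p : Atoms) : Set (Letter Atoms × List (Letter Atoms)) :=
  {κ | Leads T (toWord κ) p ∧ κ.2.length ≤ 131}

theorem smul_mem_cores {T : Finset Atoms} {p : Atoms} (π : Equiv.Perm Atoms)
    (hπ : ∀ x ∈ insert p T, π x = x) (κ : Letter Atoms × List (Letter Atoms))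
    (hκ : κ ∈ cores T p) : π • κ ∈ cores T p := by
  refine ⟨?_, ?_⟩
  · have := (leads_smul π).2 hκ.1
    rwa [finset_smul_eq_self fun x hx => hπ x (by simp [hx]),
      show π • p = p from hπ p (by simp)] at this
  · have := hκ.2
    rwa [Prod.smul_snd, word_smul_eq, List.length_map]

/-- One inclusion is the decomposition `exists_core`, the other the reinsertion
`exists_insert_periods`. -/
theorem parikh_image_antiPaths (a b c : Atoms) :
    parikh '' (antiPaths b c a) = ⋃ κ ∈ cores {b, c} a, coreSet {b, c} a κ := by
  ext x
  simp only [Set.mem_iUnion, Set.mem_image, mem_coreSet, mem_antiPaths_iff]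
  constructor
  · rintro ⟨w, ⟨hne, hw⟩, rfl⟩
    obtain ⟨α, w, rfl⟩ := List.exists_cons_of_ne_nil hne
    obtain ⟨k, qs, hperm, hl, hk, hq⟩ := exists_core hw
    exact ⟨(α, k), ⟨hl, hk⟩, qs, hq, Multiset.coe_eq_coe.2 hperm⟩
  · rintro ⟨κ, hκ, qs, hqs, rfl⟩
    obtain ⟨w, hp, hw⟩ := exists_insert_periods qs hκ.1 fun q hq => (hqs q hq).1
    refine ⟨w, ⟨?_, hw⟩, Multiset.coe_eq_coe.2 hp⟩
    rintro rfl
    simpa [toWord] using hp.length_eq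

end Renaming

theorem mainTheorem4 {Atoms : Type*} [DecidableEq Atoms] [Countable Atoms] [Infinite Atoms]
    (a b c : Atoms) : HasRationalParikhImage Atoms (antiPaths b c a) := by
  rw [HasRationalParikhImage, parikh_image_antiPaths]
  refine .iUnion _ _ (orbitFinite_of_length_le smul_mem_cores fun κ hκ => hκ.2)
    ⟨insert a {b, c}, fun π hπ => ⟨smul_set_eq smul_mem_cores hπ, fun κ _ => ?_⟩⟩
    fun κ _ => isRational_coreSet _ _ κ
  exact coreSet_smul (finset_smul_eq_self fun x hx => hπ x (Finset.mem_insert_of_mem hx))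
    (hπ a (Finset.mem_insert_self _ _)) κ
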